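/- Let $R_0$ be an integral domain which is finitely generated as a $\mathbb{Z}$-algebra and has infinitely many pairwise non-associate prime elements. Let $R = R_0[s,t]$ be the polynomial ring in two variables over $R_0$ and let $F$ be the field of fractions of $R$. For a commutative ring $S$, let $E_2(S)$ denote the subgroup of $SL_2(S)$ generated by all matrices $\begin{pmatrix} 1 & r\\ 0 & 1\end{pmatrix}$ and $\begin{pmatrix} 1 & 0\\ r & 1\end{pmatrix}$ with $r \in S$. Then $SL_2(R)$ is not contained in $E_2(S)$ for any finitely generated $R$-subalgebra $S$ of $F$. Equivalently, no group $\Gamma$ with $SL_2(R) \le \Gamma \le SL_2(F)$ is finitely generated. -/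

import Mathlib

open Matrix

/-- The elementary matrix `E₁₂(r)`, the upper unitriangular matrix with rows `(1, r)`, `(0, 1)`. -/
def E12 {A : Type*} [CommRing A] (r : A) : SpecialLinearGroup (Fin 2) A :=
  ⟨!![1, r; 0, 1], by simp [Matrix.det_fin_two]⟩

/-- The elementary matrix `E₂₁(r)`, the lower unitriangular matrix with rows `(1, 0)`, `(r, 1)`. -/
def E21 {A : Type*} [CommRing A] (r : A) : SpecialLinearGroup (Fin 2) A :=
  ⟨!![1, 0; r, 1], by simp [Matrix.det_fin_two]⟩

/-- `E₂(A)`: the subgroup of `SL₂(A)` generated by all elementary matrices over `A`. -/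
def E2 (A : Type*) [CommRing A] : Subgroup (SpecialLinearGroup (Fin 2) A) :=
  Subgroup.closure (Set.range (E12 (A := A)) ∪ Set.range (E21 (A := A)))

/-- `SL₂(R)` regarded as a subgroup of `SL₂(F)`, for an `R`-algebra `F`
(the entrywise image; it is used only where `R → F` is injective). -/
def SL2In (R F : Type*) [CommRing R] [CommRing F] [Algebra R F] :
    Subgroup (SpecialLinearGroup (Fin 2) F) :=
  (SpecialLinearGroup.map (n := Fin 2) (algebraMap R F)).range

/-- `E₂(S)` regarded as a subgroup of `SL₂(F)`, for an `R`-subalgebra `S` of `F`. -/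
def E2In {R F : Type*} [CommRing R] [CommRing F] [Algebra R F] (S : Subalgebra R F) :
    Subgroup (SpecialLinearGroup (Fin 2) F) :=
  (E2 S).map (SpecialLinearGroup.map (n := Fin 2) (algebraMap S F))

/-! Write `R` as `R₀[X][X]`. A finitely generated `S` lies in `R[1/f]` for some `f ≠ 0`. Let `c` be
the leading coefficient of `f` in the outer variable and `A = R₀[X][1/c]`. Sending the outer
variable to `z⁻¹` embeds `R` in `A((z))` and makes `f` a unit, so `E₂(S)` maps into `E₂(A((z)))`. It
then suffices to find a matrix of `SL₂(R)` whose image is outside `E₂(A((z)))`; Cohn's matrix of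
`(p, q z⁻¹)` is one (`cohnMatrix_notMem_E2`) if `p` is prime in `A`, `p ∤ q`, and `p`, `q` are not
comaximal.

The obstruction: `E₂(A((z)))` lies in the group generated by `SL₂(A[[z]])` and its conjugate by
`diag(z, 1)` (`E2_le_sup`). Over a domain `A`, pole orders measure the length of reduced words
(`ReducedWord.leading`). The order-two pole of Cohn's matrix fixes the length, and comparing
coefficients makes `p` and `q` comaximal. -/

section SL2

/-! ### Two-by-two matrices of determinant one -/

variable {B : Type*} [CommRing B]

theorem SL2_mul_apply (g h : SpecialLinearGroup (Fin 2) B) (i j : Fin 2) :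
    (g * h) i j = g i 0 * h 0 j + g i 1 * h 1 j := by
  simp [Matrix.mul_apply]

theorem SL2_inv_apply (g : SpecialLinearGroup (Fin 2) B) :
    g⁻¹ 0 0 = g 1 1 ∧ g⁻¹ 0 1 = -g 0 1 ∧ g⁻¹ 1 0 = -g 1 0 ∧ g⁻¹ 1 1 = g 0 0 := by
  rw [SpecialLinearGroup.SL2_inv_expl]; simp

theorem SL2_det (g : SpecialLinearGroup (Fin 2) B) : g 0 0 * g 1 1 - g 0 1 * g 1 0 = 1 := by
  have h : (g : Matrix (Fin 2) (Fin 2) B).det = 1 := g.2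
  rwa [Matrix.det_fin_two] at h

theorem SL2_ext {g h : SpecialLinearGroup (Fin 2) B} (h00 : g 0 0 = h 0 0) (h01 : g 0 1 = h 0 1)
    (h10 : g 1 0 = h 1 0) (h11 : g 1 1 = h 1 1) : g = h :=
  Matrix.SpecialLinearGroup.ext g h fun i j => by fin_cases i <;> fin_cases j <;> assumption

/-- The matrix with rows `(a, b)` and `(c, d)`. -/
def SL2Mk (a b c d : B) (h : a * d - b * c = 1) : SpecialLinearGroup (Fin 2) B :=
  ⟨!![a, b; c, d], by rwa [Matrix.det_fin_two_of]⟩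

section

variable (a b c d : B) (h : a * d - b * c = 1)

@[simp] theorem SL2Mk_zero_zero : SL2Mk a b c d h 0 0 = a := rfl

@[simp] theorem SL2Mk_zero_one : SL2Mk a b c d h 0 1 = b := rfl

@[simp] theorem SL2Mk_one_zero : SL2Mk a b c d h 1 0 = c := rfl

@[simp] theorem SL2Mk_one_one : SL2Mk a b c d h 1 1 = d := rfl

end

theorem E12_eq (r : B) : E12 r = SL2Mk 1 r 0 1 (by ring) := rfl

theorem E21_eq (r : B) : E21 r = SL2Mk 1 0 r 1 (by ring) := rfl

/-- Cohn's matrix attached to the pair `(a, b)`. -/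
def cohnMatrix (a b : B) : SpecialLinearGroup (Fin 2) B :=
  SL2Mk (1 - a * b) (a ^ 2) (-b ^ 2) (1 + a * b) (by ring)

end SL2

/-! ### Laurent series and reduced words in two parahoric subgroups -/

section LaurentSeries

variable {A : Type*} [CommRing A]

/-- The Laurent series `x` has no coefficients in degrees below `m`. -/
def VanishBelow (m : ℤ) (x : LaurentSeries A) : Prop := ∀ i < m, x.coeff i = 0

namespace VanishBelow

variable {m n : ℤ} {x y : LaurentSeries A}

theorem mono (hx : VanishBelow m x) (h : n ≤ m) : VanishBelow n x :=
  fun i hi => hx i (hi.trans_le h)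

theorem add (hx : VanishBelow m x) (hy : VanishBelow m y) : VanishBelow m (x + y) :=
  fun i hi => by simp [hx i hi, hy i hi]

theorem neg (hx : VanishBelow m x) : VanishBelow m (-x) :=
  fun i hi => by simp [hx i hi]

theorem mul (hx : VanishBelow m x) (hy : VanishBelow n y) : VanishBelow (m + n) (x * y) := by
  intro i hi
  rw [HahnSeries.coeff_mul]
  refine Finset.sum_eq_zero fun ij hij => ?_
  rw [Finset.mem_antidiagonal] at hij
  by_cases h : ij.1 < m
  · rw [hx _ h, zero_mul]
  · rw [hy _ (by omega), mul_zero]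

theorem coeff_mul (hx : VanishBelow m x) (hy : VanishBelow n y) :
    (x * y).coeff (m + n) = x.coeff m * y.coeff n := by
  rw [HahnSeries.coeff_mul]
  rw [Finset.sum_eq_single (m, n)]
  · intro ij hij hne
    rw [Finset.mem_antidiagonal] at hij
    by_cases h : ij.1 < m
    · rw [hx _ h, zero_mul]
    · by_cases h' : ij.2 < n
      · rw [hy _ h', mul_zero]
      · exact absurd (Prod.ext (by simp; omega) (by simp; omega)) hne
  · intro h
    rw [Finset.mem_antidiagonal] at h
    by_contra h0
    exact h ⟨fun h1 => h0 (by simp [h1]), fun h2 => h0 (by simp [h2]), rfl⟩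

theorem coeff_mul_of_eq {k : ℤ} (hx : VanishBelow m x) (hy : VanishBelow n y) (hk : k = m + n) :
    (x * y).coeff k = x.coeff m * y.coeff n := hk ▸ hx.coeff_mul hy

theorem coeff_mul_eq_zero {k : ℤ} (hx : VanishBelow m x) (hy : VanishBelow n y) (hk : k < m + n) :
    (x * y).coeff k = 0 := hx.mul hy k hk

theorem succ (hx : VanishBelow m x) (h : x.coeff m = 0) : VanishBelow (m + 1) x := by
  intro i hi
  rcases (Int.lt_add_one_iff.mp hi).lt_or_eq with h' | rfl
  · exact hx i h'
  · exact h

theorem zero : VanishBelow m (0 : LaurentSeries A) := fun _ _ => rfl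

theorem single (a : A) (h : m ≤ n) : VanishBelow m (HahnSeries.single n a) :=
  fun _ hi => HahnSeries.coeff_single_of_ne (hi.trans_le h).ne

theorem one : VanishBelow 0 (1 : LaurentSeries A) := single 1 le_rfl

end VanishBelow

theorem exists_vanishBelow (x : LaurentSeries A) : ∃ n : ℕ, VanishBelow (-n : ℤ) x := by
  by_cases hx : x = 0
  · exact ⟨0, hx ▸ VanishBelow.zero⟩
  · refine ⟨(-x.order).toNat, fun i hi => HahnSeries.coeff_eq_zero_of_lt_order ?_⟩
    have := Int.self_le_toNat (-x.order)
    omega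

/-- The matrices of determinant one over `A((z))` whose diagonal entries are power series, and whose
off-diagonal entries are divisible by `z ^ a` and `z ^ b`. -/
def parahoric (A : Type*) [CommRing A] (a b : ℤ) (hab : 0 ≤ a + b) :
    Subgroup (SpecialLinearGroup (Fin 2) (LaurentSeries A)) where
  carrier := {g | VanishBelow 0 (g 0 0) ∧ VanishBelow a (g 0 1) ∧ VanishBelow b (g 1 0) ∧
    VanishBelow 0 (g 1 1)}
  one_mem' := ⟨VanishBelow.one, VanishBelow.zero, VanishBelow.zero, VanishBelow.one⟩
  mul_mem' := by
    rintro g h ⟨g1, g2, g3, g4⟩ ⟨h1, h2, h3, h4⟩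
    refine ⟨?_, ?_, ?_, ?_⟩ <;> rw [SL2_mul_apply]
    · exact ((g1.mul h1).mono (n := 0) (by omega)).add ((g2.mul h3).mono (by omega))
    · exact ((g1.mul h2).mono (n := a) (by omega)).add ((g2.mul h4).mono (by omega))
    · exact ((g3.mul h1).mono (n := b) (by omega)).add ((g4.mul h3).mono (by omega))
    · exact ((g3.mul h2).mono (n := 0) (by omega)).add ((g4.mul h4).mono (by omega))
  inv_mem' := by
    rintro g ⟨g1, g2, g3, g4⟩
    obtain ⟨e1, e2, e3, e4⟩ := SL2_inv_apply g
    exact ⟨e1 ▸ g4, e2 ▸ g2.neg, e3 ▸ g3.neg, e4 ▸ g1⟩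

theorem mem_parahoric {a b : ℤ} {hab : 0 ≤ a + b}
    {g : SpecialLinearGroup (Fin 2) (LaurentSeries A)} :
    g ∈ parahoric A a b hab ↔ VanishBelow 0 (g 0 0) ∧ VanishBelow a (g 0 1) ∧
      VanishBelow b (g 1 0) ∧ VanishBelow 0 (g 1 1) := Iff.rfl

/-- `SL₂(A[[z]])`. -/
abbrev SL2Int (A : Type*) [CommRing A] := parahoric A 0 0 (by norm_num)

/-- The conjugate of `SL₂(A[[z]])` by `diag(z, 1)`. -/
abbrev SL2Conj (A : Type*) [CommRing A] := parahoric A (-1) 1 (by norm_num)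

/-- The intersection of `SL₂(A[[z]])` with its conjugate by `diag(z, 1)`. -/
abbrev Iwahori (A : Type*) [CommRing A] := parahoric A 0 1 (by norm_num)

theorem iwahori_le_SL2Int : Iwahori A ≤ SL2Int A :=
  fun _ ⟨h1, h2, h3, h4⟩ => ⟨h1, h2, h3.mono (by norm_num), h4⟩

theorem iwahori_le_SL2Conj : Iwahori A ≤ SL2Conj A :=
  fun _ ⟨h1, h2, h3, h4⟩ => ⟨h1, h2.mono (by norm_num), h3, h4⟩

theorem coeff_ne_zero_of_notMem_iwahori {g : SpecialLinearGroup (Fin 2) (LaurentSeries A)}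
    (hg : g ∈ SL2Int A) (hg' : g ∉ Iwahori A) : (g 1 0).coeff 0 ≠ 0 :=
  fun h => hg' ⟨hg.1, hg.2.1, hg.2.2.1.succ h, hg.2.2.2⟩

theorem coeff_ne_zero_of_notMem_iwahori' {k : SpecialLinearGroup (Fin 2) (LaurentSeries A)}
    (hk : k ∈ SL2Conj A) (hk' : k ∉ Iwahori A) : (k 0 1).coeff (-1) ≠ 0 :=
  fun h => hk' ⟨hk.1, hk.2.1.succ h, hk.2.2.1, hk.2.2.2⟩

/-- Reduced words in the two factors `SL2Int A` and `SL2Conj A`, beginning in `SL2Conj A` and ending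
in `SL2Int A`; the index is one less than the number of letters from `SL2Conj A`. -/
inductive ReducedWord : ℕ → SpecialLinearGroup (Fin 2) (LaurentSeries A) → Prop
  | base (k g) (hk : k ∈ SL2Conj A) (hk' : k ∉ Iwahori A) (hg : g ∈ SL2Int A) :
      ReducedWord 0 (k * g)
  | step (n k g h) (hk : k ∈ SL2Conj A) (hk' : k ∉ Iwahori A) (hg : g ∈ SL2Int A)
      (hg' : g ∉ Iwahori A) (hh : ReducedWord n h) : ReducedWord (n + 1) (k * (g * h))

/-- A letter lying in `Iwahori A` belongs to both factors, so it is absorbed by a neighbour. Only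
existence of reduced forms is needed, not uniqueness. -/
theorem reducedWord_conj_mul {k x : SpecialLinearGroup (Fin 2) (LaurentSeries A)}
    (hk : k ∈ SL2Conj A)
    (hx : x ∈ SL2Int A ∨ ∃ n, ∃ g ∈ SL2Int A, ∃ h, ReducedWord n h ∧ x = g * h) :
    k * x ∈ SL2Int A ∨ ∃ n, ∃ g ∈ SL2Int A, ∃ h, ReducedWord n h ∧ k * x = g * h := by
  by_cases hk' : k ∈ Iwahori A
  · have hk1 := iwahori_le_SL2Int hk'
    rcases hx with hx | ⟨n, g, hg, h, hh, rfl⟩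
    · exact .inl (mul_mem hk1 hx)
    · exact .inr ⟨n, k * g, mul_mem hk1 hg, h, hh, by group⟩
  rcases hx with hx | ⟨n, g, hg, h, hh, rfl⟩
  · exact .inr ⟨0, 1, one_mem _, _, .base k x hk hk' hx, by group⟩
  by_cases hg' : g ∈ Iwahori A
  · have hkg : k * g ∈ SL2Conj A := mul_mem hk (iwahori_le_SL2Conj hg')
    cases hh with
    | base k1 g1 hk1 hk1' hg1 =>
      by_cases h1 : k * g * k1 ∈ Iwahori A
      · exact .inl (by simpa [mul_assoc] using mul_mem (iwahori_le_SL2Int h1) hg1)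
      · exact .inr ⟨0, 1, one_mem _, _, .base _ g1 (mul_mem hkg hk1) h1 hg1, by group⟩
    | step n k1 g1 h1 hk1 hk1' hg1 hg1' hh1 =>
      by_cases h2 : k * g * k1 ∈ Iwahori A
      · exact .inr ⟨n, _, mul_mem (iwahori_le_SL2Int h2) hg1, h1, hh1, by group⟩
      · exact .inr ⟨_, 1, one_mem _, _, .step n _ g1 h1 (mul_mem hkg hk1) h2 hg1 hg1' hh1, by group⟩
  · exact .inr ⟨_, 1, one_mem _, _, .step n k g h hk hk' hg hg' hh, by group⟩

theorem reducedWord_of_mem_sup {x : SpecialLinearGroup (Fin 2) (LaurentSeries A)}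
    (hx : x ∈ SL2Int A ⊔ SL2Conj A) :
    x ∈ SL2Int A ∨ ∃ n, ∃ g ∈ SL2Int A, ∃ h, ReducedWord n h ∧ x = g * h := by
  rw [← Subgroup.closure_eq (SL2Int A), ← Subgroup.closure_eq (SL2Conj A),
    ← Subgroup.closure_union] at hx
  have key : ∀ y ∈ (SL2Int A : Set _) ∪ (SL2Conj A : Set _), ∀ x,
      (x ∈ SL2Int A ∨ ∃ n, ∃ g ∈ SL2Int A, ∃ h, ReducedWord n h ∧ x = g * h) →
      (y * x ∈ SL2Int A ∨ ∃ n, ∃ g ∈ SL2Int A, ∃ h, ReducedWord n h ∧ y * x = g * h) := by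
    rintro y (hy | hy) x hx
    · rcases hx with hx | ⟨n, g, hg, h, hh, rfl⟩
      · exact .inl (mul_mem hy hx)
      · exact .inr ⟨n, y * g, mul_mem hy hg, h, hh, by group⟩
    · exact reducedWord_conj_mul hy hx
  induction hx using Subgroup.closure_induction_left with
  | one => exact .inl (one_mem _)
  | mul_left y hy x _ ih => exact key y hy x ih
  | inv_mul_cancel y hy x _ ih =>
    exact key _ (hy.imp (fun h => inv_mem h) (fun h => inv_mem h)) x ih

theorem single_mul_single_inv :
    (HahnSeries.single 1 1 * HahnSeries.single (-1) 1 : LaurentSeries A) = 1 := by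
  simp

/-- The diagonal matrix `diag(z, z⁻¹)`. -/
noncomputable def diagZ (A : Type*) [CommRing A] : SpecialLinearGroup (Fin 2) (LaurentSeries A) :=
  SL2Mk (HahnSeries.single 1 1) 0 0 (HahnSeries.single (-1) 1) (by
    rw [single_mul_single_inv, zero_mul, sub_zero])

/-- `diagZ A` is a product of two antidiagonal matrices, one in each factor. -/
theorem diagZ_mem : diagZ A ∈ SL2Int A ⊔ SL2Conj A := by
  have h : diagZ A = SL2Mk 0 (-1) 1 0 (by ring) *
      SL2Mk 0 (HahnSeries.single (-1) 1) (-HahnSeries.single 1 1) 0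
        (by linear_combination single_mul_single_inv (A := A)) := by
    apply SL2_ext <;> simp [diagZ, SL2_mul_apply]
  rw [h]
  refine mul_mem (Subgroup.mem_sup_left ?_) (Subgroup.mem_sup_right ?_)
  · exact ⟨VanishBelow.zero, VanishBelow.one.neg, VanishBelow.one, VanishBelow.zero⟩
  · exact ⟨VanishBelow.zero, .single 1 le_rfl, (VanishBelow.single 1 le_rfl).neg, VanishBelow.zero⟩

/-- Conjugation by `diagZ A` multiplies the off-diagonal entry by `z ^ 2` or `z ^ (-2)`, which lets
the pole order be lowered until the matrix is integral. -/
theorem elementary_mem_of_vanishBelow (n : ℕ) : ∀ x : LaurentSeries A, VanishBelow (-n : ℤ) x →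
    E12 x ∈ SL2Int A ⊔ SL2Conj A ∧ E21 x ∈ SL2Int A ⊔ SL2Conj A := by
  induction n with
  | zero =>
    intro x hx
    have hx : VanishBelow 0 x := by simpa using hx
    exact ⟨Subgroup.mem_sup_left ⟨.one, hx, .zero, .one⟩,
      Subgroup.mem_sup_left ⟨.one, .zero, hx, .one⟩⟩
  | succ n ih =>
    intro x hx
    have hz := single_mul_single_inv (A := A)
    have hy := ih (HahnSeries.single 1 1 * (HahnSeries.single 1 1 * x))
      (((VanishBelow.single 1 le_rfl).mul ((VanishBelow.single 1 le_rfl).mul hx)).mono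
        (by push_cast; omega))
    have h12 : E12 x = (diagZ A)⁻¹ * E12 (HahnSeries.single 1 1 * (HahnSeries.single 1 1 * x)) *
        diagZ A := by
      rw [mul_assoc, eq_inv_mul_iff_mul_eq]
      apply SL2_ext <;>
        simp only [diagZ, E12_eq, SL2_mul_apply, SL2Mk_zero_zero, SL2Mk_zero_one, SL2Mk_one_zero,
          SL2Mk_one_one]
      · ring
      · linear_combination (-HahnSeries.single 1 1 * x : LaurentSeries A) * hz
      · ring
      · ring
    have h21 : E21 x = diagZ A * E21 (HahnSeries.single 1 1 * (HahnSeries.single 1 1 * x)) *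
        (diagZ A)⁻¹ := by
      rw [eq_mul_inv_iff_mul_eq]
      apply SL2_ext <;>
        simp only [diagZ, E21_eq, SL2_mul_apply, SL2Mk_zero_zero, SL2Mk_zero_one, SL2Mk_one_zero,
          SL2Mk_one_one]
      · ring
      · ring
      · linear_combination (-HahnSeries.single 1 1 * x : LaurentSeries A) * hz
      · ring
    rw [h12, h21]
    exact ⟨mul_mem (mul_mem (inv_mem diagZ_mem) hy.1) diagZ_mem,
      mul_mem (mul_mem diagZ_mem hy.2) (inv_mem diagZ_mem)⟩

theorem E2_le_sup : E2 (LaurentSeries A) ≤ SL2Int A ⊔ SL2Conj A := by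
  refine (Subgroup.closure_le _).mpr ?_
  rintro _ (⟨x, rfl⟩ | ⟨x, rfl⟩) <;> obtain ⟨n, hn⟩ := exists_vanishBelow x
  exacts [(elementary_mem_of_vanishBelow n x hn).1, (elementary_mem_of_vanishBelow n x hn).2]

theorem exists_coeff_ne_zero_of_mem [Nontrivial A]
    {g : SpecialLinearGroup (Fin 2) (LaurentSeries A)} (hg : g ∈ SL2Int A) :
    ∃ j, (g 1 j).coeff 0 ≠ 0 := by
  by_contra! h
  have hdet := congrArg (fun x => HahnSeries.coeff x 0) (SL2_det g)
  simp only [HahnSeries.coeff_sub, hg.1.coeff_mul_of_eq hg.2.2.2 (zero_add 0).symm,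
    hg.2.1.coeff_mul_of_eq hg.2.2.1 (zero_add 0).symm, h, mul_zero, sub_zero,
    HahnSeries.coeff_one, if_true] at hdet
  exact zero_ne_one hdet

/-- A letter from `SL2Conj A` carries the leading term of the bottom row to the top row with one
more pole; a letter from `SL2Int A` outside `Iwahori A` carries it back down. No product of leading
coefficients vanishes, as `A` is a domain. -/
theorem ReducedWord.leading [IsDomain A] {n : ℕ}
    {h : SpecialLinearGroup (Fin 2) (LaurentSeries A)} (hh : ReducedWord n h) :
    (∀ j, VanishBelow (-(n + 1) : ℤ) (h 0 j)) ∧ (∀ j, VanishBelow (-n : ℤ) (h 1 j)) ∧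
      ∃ j, (h 0 j).coeff (-(n + 1) : ℤ) ≠ 0 := by
  have aux : ∀ (m : ℤ) (k y : SpecialLinearGroup (Fin 2) (LaurentSeries A)), k ∈ SL2Conj A →
      k ∉ Iwahori A → (∀ i j, VanishBelow (-m) (y i j)) → (∃ j, (y 1 j).coeff (-m) ≠ 0) →
      (∀ j, VanishBelow (-(m + 1)) ((k * y) 0 j)) ∧ (∀ j, VanishBelow (-m) ((k * y) 1 j)) ∧
      ∃ j, ((k * y) 0 j).coeff (-(m + 1)) ≠ 0 := by
    rintro m k y hk hk' hy ⟨j, hj⟩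
    simp only [SL2_mul_apply]
    refine ⟨fun j => ?_, fun j => ?_, j, ?_⟩
    · exact ((hk.1.mul (hy 0 j)).mono (by omega)).add ((hk.2.1.mul (hy 1 j)).mono (by omega))
    · exact ((hk.2.2.1.mul (hy 0 j)).mono (by omega)).add
        ((hk.2.2.2.mul (hy 1 j)).mono (by omega))
    · rw [HahnSeries.coeff_add, hk.1.coeff_mul_eq_zero (hy 0 j) (by omega),
        hk.2.1.coeff_mul_of_eq (hy 1 j) (by omega), zero_add]
      exact mul_ne_zero (coeff_ne_zero_of_notMem_iwahori' hk hk') hj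
  induction hh with
  | base k g hk hk' hg =>
    refine aux ((0 : ℕ) : ℤ) k g hk hk' ?_ ?_
    · intro i j
      rw [Nat.cast_zero, neg_zero]
      fin_cases i <;> fin_cases j
      exacts [hg.1, hg.2.1, hg.2.2.1, hg.2.2.2]
    · simpa using exists_coeff_ne_zero_of_mem hg
  | step n k g h hk hk' hg hg' hh ih =>
    obtain ⟨h1, h2, j, hj⟩ := ih
    refine aux ((n + 1 : ℕ) : ℤ) k (g * h) hk hk' ?_ ⟨j, ?_⟩
    · rw [Fin.forall_fin_two]
      simp only [SL2_mul_apply]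
      push_cast
      exact ⟨fun j => ((hg.1.mul (h1 j)).mono (by omega)).add
        ((hg.2.1.mul (h2 j)).mono (by omega)),
        fun j => ((hg.2.2.1.mul (h1 j)).mono (by omega)).add
        ((hg.2.2.2.mul (h2 j)).mono (by omega))⟩
    · simp only [SL2_mul_apply]
      push_cast
      rw [HahnSeries.coeff_add, hg.2.2.1.coeff_mul_of_eq (h1 j) (by omega),
        hg.2.2.2.coeff_mul_eq_zero (h2 j) (by omega), add_zero]
      exact mul_ne_zero (coeff_ne_zero_of_notMem_iwahori hg hg') hj

theorem cohnMatrix_notMem_E2 [IsDomain A] {p q : A} (hp : Prime p) (hpq : ¬ p ∣ q)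
    (hcop : ¬ IsCoprime p q) :
    cohnMatrix (HahnSeries.C p) (HahnSeries.single (-1) q) ∉ E2 (LaurentSeries A) := by
  intro hM
  have hq : q ≠ 0 := fun h => hpq (h ▸ dvd_zero p)
  set M := cohnMatrix (HahnSeries.C p) (HahnSeries.single (-1 : ℤ) q) with hMdef
  have e00 : M 0 0 = 1 - HahnSeries.single (-1) (p * q) := by
    simp [hMdef, cohnMatrix, HahnSeries.C_apply]
  have e01 : M 0 1 = HahnSeries.single 0 (p ^ 2) := by
    simp [hMdef, cohnMatrix, HahnSeries.C_apply, sq]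
  have e10 : M 1 0 = - HahnSeries.single (-2) (q ^ 2) := by
    simp [hMdef, cohnMatrix, sq]
  have e11 : M 1 1 = 1 + HahnSeries.single (-1) (p * q) := by
    simp [hMdef, cohnMatrix, HahnSeries.C_apply]
  have v00 : VanishBelow (-1) (M 0 0) := by
    rw [e00, sub_eq_add_neg]
    exact (VanishBelow.one.mono (by norm_num)).add (VanishBelow.single _ le_rfl).neg
  have v01 : VanishBelow (-1) (M 0 1) := by rw [e01]; exact .single _ (by norm_num)
  have v10 : VanishBelow (-2) (M 1 0) := by rw [e10]; exact (VanishBelow.single _ le_rfl).neg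
  have v11 : VanishBelow (-2) (M 1 1) := by
    rw [e11]
    exact (VanishBelow.one.mono (by norm_num)).add (VanishBelow.single _ (by norm_num))
  have c10 : (M 1 0).coeff (-2) = - q ^ 2 := by simp [e10]
  have c00 : (M 0 0).coeff (-1) = - (p * q) := by simp [e00, HahnSeries.coeff_one]
  have c10ne : (M 1 0).coeff (-2) ≠ 0 := by simp [c10, hq]
  rcases reducedWord_of_mem_sup (E2_le_sup hM) with h | ⟨n, g, hg, h, hh, hgh⟩
  · exact c10ne (h.2.2.1 _ (by norm_num))
  obtain ⟨l1, l2, j, lj⟩ := hh.leading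
  have V0 : ∀ j, VanishBelow (-1) (M 0 j) := Fin.forall_fin_two.mpr ⟨v00, v01⟩
  have V1 : ∀ j, VanishBelow (-2) (M 1 j) := Fin.forall_fin_two.mpr ⟨v10, v11⟩
  have hn1 : 1 ≤ n := by
    by_contra hn
    refine c10ne ?_
    rw [hgh, SL2_mul_apply]
    exact (((hg.2.2.1.mul (l1 0)).mono (by omega)).add ((hg.2.2.2.mul (l2 0)).mono (by omega)))
      _ (show (-2 : ℤ) < -1 by norm_num)
  have hn2 : n ≤ 1 := by
    by_contra hn
    refine lj ?_
    have : h = g⁻¹ * M := by rw [hgh]; group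
    have hgi := inv_mem hg
    rw [this, SL2_mul_apply]
    exact (((hgi.1.mul (V0 j)).mono (by omega)).add ((hgi.2.1.mul (V1 j)).mono (by omega)))
      _ (show -((n : ℤ) + 1) < -2 by omega)
  obtain rfl : n = 1 := le_antisymm hn2 hn1
  -- The top row of `h` has a pole of order two, that of `M` at most one.
  have hg00 : (g 0 0).coeff 0 = 0 := by
    have h1 := congrArg (fun x => HahnSeries.coeff (x 0 j) (-2)) hgh
    simp only [SL2_mul_apply] at h1
    rw [V0 j _ (by norm_num), HahnSeries.coeff_add, hg.1.coeff_mul_of_eq (l1 j) (by norm_num),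
      hg.2.1.coeff_mul_eq_zero (l2 j) (by norm_num), add_zero] at h1
    exact (mul_eq_zero.mp h1.symm).resolve_right lj
  cases hh with
  | step _ k g2 h2 hk hk' hg2 hg2' hh2 =>
  obtain ⟨m1, m2, -⟩ := hh2.leading
  -- `w` swaps the rows up to sign, moving the entry of `g` that vanishes mod `z` to the lower left
  -- corner.
  let w : SpecialLinearGroup (Fin 2) (LaurentSeries A) := SL2Mk 0 1 (-1) 0 (by ring)
  have hwg : w * g ∈ Iwahori A := by
    simp only [mem_parahoric, w, SL2_mul_apply, SL2Mk_zero_zero, SL2Mk_zero_one, SL2Mk_one_zero,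
      SL2Mk_one_one, zero_mul, one_mul, neg_mul, zero_add, add_zero]
    exact ⟨hg.2.2.1, hg.2.2.2, (hg.1.succ hg00).neg, hg.2.1.neg⟩
  have hk2 : w * g * k ∈ SL2Conj A := mul_mem (iwahori_le_SL2Conj hwg) hk
  set κ := w * g * k with hκ
  have hx : g2 * h2 = κ⁻¹ * (w * M) := by rw [hgh, hκ]; group
  have h00 : (g2 * h2) 0 0 = κ 1 1 * M 1 0 + κ 0 1 * M 0 0 := by
    obtain ⟨e1, e2, -⟩ := SL2_inv_apply κ
    rw [hx, SL2_mul_apply, e1, e2]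
    simp [w, SL2_mul_apply]
  -- The shorter word `h2` has poles of order at most one; this cancellation yields the relation `p
  -- * b = -(d * q)`.
  have heq : ((g2 * h2) 0 0).coeff (-2) = 0 := by
    rw [SL2_mul_apply]
    exact (((hg2.1.mul (m1 0)).mono (by norm_num)).add ((hg2.2.1.mul (m2 0)).mono (by norm_num)))
      _ (show (-2 : ℤ) < -1 by norm_num)
  rw [h00, HahnSeries.coeff_add, hk2.2.2.2.coeff_mul_of_eq v10 (by norm_num),
    hk2.2.1.coeff_mul_of_eq v00 (by norm_num), c10, c00] at heq
  have hdet := congrArg (fun x => HahnSeries.coeff x 0) (SL2_det κ)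
  simp only [HahnSeries.coeff_sub, hk2.1.coeff_mul_of_eq hk2.2.2.2 (zero_add 0).symm,
    hk2.2.1.coeff_mul_of_eq hk2.2.2.1 (show (0 : ℤ) = -1 + 1 by norm_num),
    HahnSeries.coeff_one, if_true] at hdet
  generalize (κ 1 1).coeff 0 = d at *
  generalize (κ 0 1).coeff (-1) = b at *
  have hbd : p * b = -(d * q) := mul_left_cancel₀ hq (by linear_combination -heq)
  obtain ⟨e, rfl⟩ : p ∣ d :=
    (hp.dvd_or_dvd (dvd_neg.mp ⟨b, hbd.symm⟩)).resolve_right hpq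
  have hb : b = -(e * q) := mul_left_cancel₀ hp.ne_zero (by linear_combination hbd)
  exact hcop ⟨(κ 0 0).coeff 0 * e, e * (κ 1 0).coeff 1, by
    rw [hb] at hdet; linear_combination hdet⟩

end LaurentSeries

/-! ### Elementary groups over subalgebras of the fraction field -/

section GroupsOverFractionFields

theorem SL2_map_apply {A B : Type*} [CommRing A] [CommRing B] (f : A →+* B)
    (g : SpecialLinearGroup (Fin 2) A) (i j : Fin 2) :
    SpecialLinearGroup.map (n := Fin 2) f g i j = f (g i j) := rfl

theorem map_E12 {A B : Type*} [CommRing A] [CommRing B] (f : A →+* B) (r : A) :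
    SpecialLinearGroup.map (n := Fin 2) f (E12 r) = E12 (f r) := by
  apply SL2_ext <;> simp [E12_eq, SL2_map_apply]

theorem map_E21 {A B : Type*} [CommRing A] [CommRing B] (f : A →+* B) (r : A) :
    SpecialLinearGroup.map (n := Fin 2) f (E21 r) = E21 (f r) := by
  apply SL2_ext <;> simp [E21_eq, SL2_map_apply]

theorem map_cohnMatrix {A B : Type*} [CommRing A] [CommRing B] (f : A →+* B) (a b : A) :
    SpecialLinearGroup.map (n := Fin 2) f (cohnMatrix a b) = cohnMatrix (f a) (f b) := by
  apply SL2_ext <;> simp [cohnMatrix, SL2_map_apply]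

theorem SL2_map_injective {A B : Type*} [CommRing A] [CommRing B] {f : A →+* B}
    (hf : Function.Injective f) : Function.Injective (SpecialLinearGroup.map (n := Fin 2) f) := by
  intro g h hgh
  have key : ∀ i j, g i j = h i j := fun i j => hf (congrArg (fun x => x.1 i j) hgh)
  exact SL2_ext (key _ _) (key _ _) (key _ _) (key _ _)

theorem E12_mem_E2 {A : Type*} [CommRing A] (r : A) : E12 r ∈ E2 A :=
  Subgroup.subset_closure (.inl ⟨r, rfl⟩)

theorem E21_mem_E2 {A : Type*} [CommRing A] (r : A) : E21 r ∈ E2 A :=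
  Subgroup.subset_closure (.inr ⟨r, rfl⟩)

theorem E2_eq_top (F : Type*) [Field F] : E2 F = ⊤ := by
  have key : ∀ g : SpecialLinearGroup (Fin 2) F, g 1 0 ≠ 0 → g ∈ E2 F := by
    intro g hg
    have hdet := SL2_det g
    have h : g = E12 ((g 0 0 - 1) / g 1 0) * E21 (g 1 0) * E12 ((g 1 1 - 1) / g 1 0) := by
      apply SL2_ext <;>
        simp only [E12_eq, E21_eq, SL2_mul_apply, SL2Mk_zero_zero, SL2Mk_zero_one, SL2Mk_one_zero,
          SL2Mk_one_one] <;> field_simp <;> first | ring1 | linear_combination -hdet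
    rw [h]
    exact mul_mem (mul_mem (E12_mem_E2 _) (E21_mem_E2 _)) (E12_mem_E2 _)
  refine (Subgroup.eq_top_iff' _).mpr fun g => ?_
  by_cases hg : g 1 0 = 0
  · have h1 : (E21 1 * g : SpecialLinearGroup (Fin 2) F) 1 0 ≠ 0 := by
      have hdet := SL2_det g
      rw [SL2_mul_apply, E21_eq, SL2Mk_one_zero, SL2Mk_one_one, hg, mul_zero, add_zero, one_mul]
      rintro h0
      simp [hg, h0] at hdet
    exact (Subgroup.mul_mem_cancel_left _ (E21_mem_E2 1)).mp (key _ h1)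
  · exact key g hg

variable {R F : Type*} [CommRing R] [Field F] [Algebra R F]

theorem E2In_mono {S T : Subalgebra R F} (h : S ≤ T) : E2In S ≤ E2In T := by
  refine Subgroup.map_le_iff_le_comap.mpr ((Subgroup.closure_le _).mpr ?_)
  rintro _ (⟨x, rfl⟩ | ⟨x, rfl⟩)
  · exact ⟨E12 ⟨x, h x.2⟩, E12_mem_E2 _, by rw [map_E12, map_E12]; rfl⟩
  · exact ⟨E21 ⟨x, h x.2⟩, E21_mem_E2 _, by rw [map_E21, map_E21]; rfl⟩

theorem exists_fg_mem_E2In (g : SpecialLinearGroup (Fin 2) F) :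
    ∃ S : Subalgebra R F, S.FG ∧ g ∈ E2In S := by
  have hg : g ∈ E2 F := E2_eq_top F ▸ Subgroup.mem_top g
  induction hg using Subgroup.closure_induction with
  | mem g hg =>
    have hx (x : F) : x ∈ Algebra.adjoin R {x} := Algebra.subset_adjoin rfl
    rcases hg with ⟨x, rfl⟩ | ⟨x, rfl⟩
    · exact ⟨Algebra.adjoin R {x}, ⟨{x}, by simp⟩, E12 ⟨x, hx x⟩, E12_mem_E2 _, map_E12 _ _⟩
    · exact ⟨Algebra.adjoin R {x}, ⟨{x}, by simp⟩, E21 ⟨x, hx x⟩, E21_mem_E2 _, map_E21 _ _⟩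
  | one => exact ⟨⊥, Subalgebra.fg_bot, one_mem _⟩
  | mul g h _ _ ihg ihh =>
    obtain ⟨S, hS, hgS⟩ := ihg
    obtain ⟨T, hT, hhT⟩ := ihh
    exact ⟨S ⊔ T, hS.sup hT, mul_mem (E2In_mono le_sup_left hgS) (E2In_mono le_sup_right hhT)⟩
  | inv g _ ih =>
    obtain ⟨S, hS, hgS⟩ := ih
    exact ⟨S, hS, inv_mem hgS⟩

theorem exists_fg_le_E2In {Γ : Subgroup (SpecialLinearGroup (Fin 2) F)} (hΓ : Γ.FG) :
    ∃ S : Subalgebra R F, S.FG ∧ Γ ≤ E2In S := by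
  classical
  obtain ⟨s, rfl⟩ := hΓ
  simp only [Subgroup.closure_le]
  induction s using Finset.induction_on with
  | empty => exact ⟨⊥, Subalgebra.fg_bot, by simp⟩
  | insert g s _ ih =>
    obtain ⟨S, hS, hsS⟩ := ih
    obtain ⟨T, hT, hgT⟩ := exists_fg_mem_E2In (R := R) g
    refine ⟨S ⊔ T, hS.sup hT, ?_⟩
    rw [Finset.coe_insert, Set.insert_subset_iff]
    exact ⟨E2In_mono le_sup_right hgT, hsS.trans (E2In_mono le_sup_left)⟩

theorem map_mem_of_mem_E2In {S : Subalgebra R F} {L E : Type*} [CommRing L] [CommRing E]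
    (φ : F →+* E) (ι : L →+* E) (hφ : ∀ x ∈ S, φ x ∈ ι.range)
    {g : SpecialLinearGroup (Fin 2) F} (hg : g ∈ E2In S) :
    SpecialLinearGroup.map φ g ∈ (E2 L).map (SpecialLinearGroup.map (n := Fin 2) ι) := by
  have h : E2In S ≤ ((E2 L).map (SpecialLinearGroup.map (n := Fin 2) ι)).comap
      (SpecialLinearGroup.map φ) := by
    refine Subgroup.map_le_iff_le_comap.mpr ((Subgroup.closure_le _).mpr ?_)
    rintro _ (⟨x, rfl⟩ | ⟨x, rfl⟩) <;> obtain ⟨l, hl⟩ := hφ x x.2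
    · exact ⟨E12 l, E12_mem_E2 _, by rw [map_E12, map_E12, map_E12, hl]; rfl⟩
    · exact ⟨E21 l, E21_mem_E2 _, by rw [map_E21, map_E21, map_E21, hl]; rfl⟩
  exact h hg

/-- `f` clears the denominators of the generators of `S`. It is chosen before the target `L`,
because `L` will depend on its leading coefficient. -/
theorem exists_common_denominator [IsFractionRing R F] {S : Subalgebra R F} (hS : S.FG) :
    ∃ f ∈ nonZeroDivisors R, ∀ {E L : Type*} [Field E] [CommRing L] (φ : F →+* E) (ι : L →+* E)
      (ψ : R →+* L), (∀ r, φ (algebraMap R F r) = ι (ψ r)) → IsUnit (ψ f) →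
      ∀ x ∈ S, φ x ∈ ι.range := by
  obtain ⟨s, rfl⟩ := hS
  obtain ⟨f, hf⟩ := IsLocalization.exist_integer_multiples_of_finset (nonZeroDivisors R) s
  refine ⟨f, f.2, fun {E L} _ _ φ ι ψ h hu x hx => ?_⟩
  induction hx using Algebra.adjoin_induction with
  | mem x hx =>
    obtain ⟨r, hr⟩ := hf x hx
    obtain ⟨u, hu⟩ := hu
    have h1 : ι (ψ r) = ι u * φ x := by
      rw [← h, hr, Algebra.smul_def, map_mul, hu, ← h]
    refine ⟨↑u⁻¹ * ψ r, ?_⟩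
    rw [map_mul, h1, ← mul_assoc, ← map_mul, Units.inv_mul, map_one, one_mul]
  | algebraMap r => exact ⟨ψ r, (h r).symm⟩
  | add x y _ _ hx hy => rw [map_add]; exact add_mem hx hy
  | mul x y _ _ hx hy => rw [map_mul]; exact mul_mem hx hy

end GroupsOverFractionFields

/-! ### Expansion of polynomials at infinity -/

section ExpansionAtInfinity

open Polynomial

variable {B A : Type*} [CommRing B] [CommRing A]

/-- The expansion at infinity of a polynomial, that is, its image under `X ↦ z⁻¹`. -/
noncomputable def expandAtInfinity (f : B →+* A) : B[X] →+* LaurentSeries A :=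
  eval₂RingHom (HahnSeries.C.comp f) (HahnSeries.single (-1) 1)

theorem expandAtInfinity_monomial (f : B →+* A) (n : ℕ) (b : B) :
    expandAtInfinity f (monomial n b) = HahnSeries.single (-n : ℤ) (f b) := by
  simp [expandAtInfinity, HahnSeries.C_apply, HahnSeries.single_pow]

theorem coeff_expandAtInfinity (f : B →+* A) (P : B[X]) (n : ℕ) :
    (expandAtInfinity f P).coeff (-n : ℤ) = f (P.coeff n) := by
  induction P using Polynomial.induction_on' with
  | add P Q hP hQ => simp [hP, hQ]
  | monomial m b =>
    rw [expandAtInfinity_monomial, HahnSeries.coeff_single, coeff_monomial]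
    by_cases h : m = n
    · simp [h]
    · simp [h, Ne.symm h]

theorem vanishBelow_expandAtInfinity (f : B →+* A) (P : B[X]) :
    VanishBelow (-P.natDegree : ℤ) (expandAtInfinity f P) := by
  intro i hi
  obtain ⟨n, rfl⟩ : ∃ n : ℕ, i = -n := ⟨i.natAbs, by omega⟩
  rw [coeff_expandAtInfinity, coeff_eq_zero_of_natDegree_lt (by omega), map_zero]

theorem expandAtInfinity_injective {f : B →+* A} (hf : Function.Injective f) :
    Function.Injective (expandAtInfinity f) := by
  refine (injective_iff_map_eq_zero _).mpr fun P hP => Polynomial.ext fun n => hf ?_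
  rw [← coeff_expandAtInfinity, hP, HahnSeries.coeff_zero, Polynomial.coeff_zero, map_zero]

theorem isUnit_expandAtInfinity [IsDomain A] {f : B →+* A} {P : B[X]}
    (hP : IsUnit (f P.leadingCoeff)) : IsUnit (expandAtInfinity f P) := by
  have h1 : (expandAtInfinity f P).coeff (-P.natDegree : ℤ) = f P.leadingCoeff :=
    coeff_expandAtInfinity f P _
  have h0 : (expandAtInfinity f P).coeff (-P.natDegree : ℤ) ≠ 0 := h1 ▸ hP.ne_zero
  have ho : (expandAtInfinity f P).order = -P.natDegree := by
    refine le_antisymm (HahnSeries.order_le_of_coeff_ne_zero h0) (not_lt.mp fun hlt => ?_)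
    exact HahnSeries.coeff_order_eq_zero.not.mpr (fun h => h0 (by rw [h, HahnSeries.coeff_zero]))
      (vanishBelow_expandAtInfinity f P _ hlt)
  rwa [HahnSeries.isUnit_iff, HahnSeries.leadingCoeff_eq, ho, h1]

end ExpansionAtInfinity

/-! ### A prime `p` and a non-comaximal `q` after localization -/

section Primes

open Polynomial

variable {R₀ : Type*} [CommRing R₀] [IsDomain R₀]

theorem exists_prime_not_dvd [IsNoetherianRing R₀]
    (hprimes : (Associates.mk '' {p : R₀ | Prime p}).Infinite) {a : R₀} (ha : a ≠ 0) :
    ∃ p : R₀, Prime p ∧ ¬ p ∣ a := by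
  classical
  by_contra! h
  obtain ⟨s, hs, hsa⟩ := WfDvdMonoid.exists_factors a ha
  refine hprimes ((s.toFinset.image Associates.mk).finite_toSet.subset ?_)
  rintro _ ⟨p, hp, rfl⟩
  obtain ⟨b, hb, hpb⟩ := hp.exists_mem_multiset_dvd ((h p hp).trans hsa.symm.dvd)
  rw [Finset.mem_coe, Finset.mem_image]
  exact ⟨b, by simpa using hb, Associates.mk_eq_mk_iff_associated.mpr
    ((hp.irreducible.associated_of_dvd (hs b hb) hpb).symm)⟩

/-- Take a prime `p` of `R₀` not dividing the leading coefficient of `c`, and `q = c * X + 1`.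
Modulo `p`, `q` is nonconstant and coprime to `c`, so inverting `c` does not make it a unit. -/
theorem exists_prime_pair [IsNoetherianRing R₀]
    (hprimes : (Associates.mk '' {p : R₀ | Prime p}).Infinite) {c : R₀[X]} (hc : c ≠ 0)
    (A : Type*) [CommRing A] [IsDomain A] [Algebra R₀[X] A] [IsLocalization.Away c A] :
    ∃ p q : R₀[X], Prime (algebraMap R₀[X] A p) ∧ ¬ algebraMap R₀[X] A p ∣ algebraMap R₀[X] A q ∧
      ¬ IsCoprime (algebraMap R₀[X] A p) (algebraMap R₀[X] A q) := by
  obtain ⟨p, hp, hpc⟩ := exists_prime_not_dvd hprimes (leadingCoeff_ne_zero.mpr hc)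
  have hCp : Prime (C p) := prime_C_iff.mpr hp
  have hCpc : ¬ C p ∣ c := fun h => hpc ((C_dvd_iff_dvd_coeff _ _).mp h _)
  have hpr : (Ideal.span {C p}).IsPrime := (Ideal.span_singleton_prime hCp.ne_zero).mpr hCp
  have hdisj : Disjoint (Submonoid.powers c : Set R₀[X]) (Ideal.span {C p} : Set R₀[X]) := by
    rw [Set.disjoint_left]
    rintro _ ⟨n, rfl⟩ h
    exact hCpc (hCp.dvd_of_dvd_pow (Ideal.mem_span_singleton.mp h))
  have hp0 : (Ideal.span {p}).IsPrime := (Ideal.span_singleton_prime hp.ne_zero).mpr hp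
  let D := R₀ ⧸ Ideal.span {p}
  let π : R₀[X] →+* D[X] := mapRingHom (Ideal.Quotient.mk (Ideal.span {p}))
  have hπp : π (C p) = 0 := by
    simp only [π, coe_mapRingHom, map_C]
    rw [Ideal.Quotient.eq_zero_iff_mem.mpr (Ideal.mem_span_singleton_self p), C_0]
  have hπc : π c ≠ 0 := by
    intro h
    have h1 := congrArg (fun P => coeff P c.natDegree) h
    simp only [π, coe_mapRingHom, coeff_map, coeff_zero] at h1
    exact hpc (Ideal.mem_span_singleton.mp (Ideal.Quotient.eq_zero_iff_mem.mp h1))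
  have hπq : π (c * X + 1) = π c * X + C 1 := by simp [π]
  have hdeg : (π (c * X + 1)).natDegree ≠ 0 := by
    rw [hπq, natDegree_add_C, natDegree_mul_X hπc]
    exact Nat.succ_ne_zero _
  have hinj : Function.Injective (algebraMap R₀[X] A) :=
    IsLocalization.injective A (M := Submonoid.powers c) (powers_le_nonZeroDivisors_of_noZeroDivisors hc)
  refine ⟨C p, c * X + 1, ?_, ?_, ?_⟩
  · rw [← Ideal.span_singleton_prime (by simpa using hinj.ne hCp.ne_zero), ← Set.image_singleton,
      ← Ideal.map_span]
    exact IsLocalization.isPrime_of_isPrime_disjoint (Submonoid.powers c) A _ hpr hdisj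
  · intro h
    have h1 : c * X + 1 ∈ ((Ideal.span {C p}).map (algebraMap R₀[X] A)).under R₀[X] := by
      rw [Ideal.under_def, Ideal.mem_comap, Ideal.map_span, Set.image_singleton]
      exact Ideal.mem_span_singleton.mpr h
    rw [IsLocalization.under_map_of_isPrime_disjoint (Submonoid.powers c) A hpr hdisj] at h1
    obtain ⟨r, hr⟩ := Ideal.mem_span_singleton.mp h1
    exact hdeg (by rw [hr, map_mul, hπp, zero_mul, natDegree_zero])
  · rintro ⟨u, v, huv⟩
    classical
    obtain ⟨⟨b, hbc⟩, hb⟩ := IsLocalization.exist_integer_multiples_of_finset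
      (Submonoid.powers c) ({u, v} : Finset A)
    obtain ⟨u', hu'⟩ := hb u (by simp)
    obtain ⟨v', hv'⟩ := hb v (by simp)
    obtain ⟨n, rfl : c ^ n = b⟩ := hbc
    rw [Algebra.smul_def] at hu' hv'
    have h1 : u' * C p + v' * (c * X + 1) = c ^ n := by
      apply hinj
      rw [map_add, map_mul, map_mul, hu', hv']
      linear_combination (algebraMap R₀[X] A (c ^ n)) * huv
    have h2 := congrArg π h1
    rw [map_add, map_mul, hπp, mul_zero, zero_add, map_mul, map_pow] at h2
    -- By `h2`, `π q` divides a power of `π c`; being coprime to it, `π q` would be a unit, hence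
    -- constant.
    have hcop : IsCoprime (π (c * X + 1)) (π c) := ⟨1, -X, by rw [hπq, C_1]; ring⟩
    exact hdeg (natDegree_eq_zero_of_isUnit
      ((hcop.pow_right (n := n)).isUnit_of_dvd ⟨π v', by rw [← h2, mul_comm]⟩))

end Primes

/-! ### The main theorem -/

section Main

open Polynomial

theorem not_SL2In_le_E2In {R₀ : Type*} [CommRing R₀] [IsDomain R₀] [IsNoetherianRing R₀]
    (hprimes : (Associates.mk '' {p : R₀ | Prime p}).Infinite)
    {R F : Type*} [CommRing R] [IsDomain R] (e : R ≃+* R₀[X][X]) [Field F] [Algebra R F]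
    [IsFractionRing R F] {S : Subalgebra R F} (hS : S.FG) : ¬ SL2In R F ≤ E2In S := by
  intro hle
  obtain ⟨f, hf, hden⟩ := exists_common_denominator hS
  have hef : e f ≠ 0 := by simpa using nonZeroDivisors.ne_zero hf
  have hc : (e f).leadingCoeff ≠ 0 := leadingCoeff_ne_zero.mpr hef
  set c := (e f).leadingCoeff with hcdef
  let A := Localization.Away c
  have hM : Submonoid.powers c ≤ nonZeroDivisors R₀[X] :=
    powers_le_nonZeroDivisors_of_noZeroDivisors hc
  have : IsDomain A := IsLocalization.isDomain_of_le_nonZeroDivisors A hM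
  have hinj : Function.Injective (algebraMap R₀[X] A) := IsLocalization.injective A hM
  obtain ⟨p, q, hp, hpq, hcop⟩ := exists_prime_pair hprimes hc A
  -- `A((z))` need not be a field, so `F` is mapped to its fraction field and `S` is seen to land in
  -- `A((z))`.
  let E := FractionRing (LaurentSeries A)
  let ψ : R →+* LaurentSeries A := (expandAtInfinity (algebraMap R₀[X] A)).comp e.toRingHom
  have hψ : Function.Injective ψ := (expandAtInfinity_injective hinj).comp e.injective
  have hι : Function.Injective (algebraMap (LaurentSeries A) E) := IsFractionRing.injective _ _
  let φ : F →+* E := IsFractionRing.lift (g := (algebraMap (LaurentSeries A) E).comp ψ)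
    (hι.comp hψ)
  have hφ : ∀ r, φ (algebraMap R F r) = algebraMap (LaurentSeries A) E (ψ r) := fun r =>
    IsFractionRing.lift_algebraMap _ r
  have hu : IsUnit (ψ f) :=
    isUnit_expandAtInfinity (IsLocalization.Away.algebraMap_isUnit c)
  let M := cohnMatrix (e.symm (C p)) (e.symm (monomial 1 q))
  have hMS : SpecialLinearGroup.map (algebraMap R F) M ∈ E2In S := hle ⟨M, rfl⟩
  obtain ⟨N, hN, hNM⟩ := map_mem_of_mem_E2In φ (algebraMap (LaurentSeries A) E)
    (hden φ _ ψ hφ hu) hMS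
  rw [map_cohnMatrix, map_cohnMatrix, hφ, hφ, ← map_cohnMatrix] at hNM
  rw [SL2_map_injective hι hNM] at hN
  refine cohnMatrix_notMem_E2 hp hpq hcop ?_
  convert hN using 2
  · simp [ψ, ← monomial_zero_left, expandAtInfinity_monomial, HahnSeries.C_apply]

end Main

theorem theorem4 {R₀ : Type*} [CommRing R₀] [IsDomain R₀] [Algebra.FiniteType ℤ R₀]
    (hprimes : (Associates.mk '' {p : R₀ | Prime p}).Infinite)
    (F : Type*) [Field F] [Algebra (MvPolynomial (Fin 2) R₀) F]
    [IsFractionRing (MvPolynomial (Fin 2) R₀) F] :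
    (∀ S : Subalgebra (MvPolynomial (Fin 2) R₀) F, S.FG →
      ¬ SL2In (MvPolynomial (Fin 2) R₀) F ≤ E2In S) ∧
    (∀ Γ : Subgroup (SpecialLinearGroup (Fin 2) F),
      SL2In (MvPolynomial (Fin 2) R₀) F ≤ Γ → ¬ Γ.FG) := by
  have : IsNoetherianRing R₀ := Algebra.FiniteType.isNoetherianRing ℤ R₀
  have key : ∀ S : Subalgebra (MvPolynomial (Fin 2) R₀) F, S.FG →
      ¬ SL2In (MvPolynomial (Fin 2) R₀) F ≤ E2In S := fun S hS =>
    not_SL2In_le_E2In hprimes ((MvPolynomial.finSuccEquiv R₀ 1).toRingEquiv.trans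
      (Polynomial.mapEquiv (MvPolynomial.uniqueAlgEquiv R₀ (Fin 1)).toRingEquiv)) hS
  refine ⟨key, fun Γ hΓ hfg => ?_⟩
  obtain ⟨S, hS, hΓS⟩ := exists_fg_le_E2In (R := MvPolynomial (Fin 2) R₀) hfg
  exact key S hS (hΓ.trans hΓS)
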